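/- Let $d\ge 0$ be an integer and let $(\delta_0,\delta_1,\dots,\delta_d)$ be a sequence of nonnegative integers with $\delta_0=1$ and $\sum_{i=0}^d\delta_i=5$. Then there are unique integers $1\le i_1\le i_2\le i_3\le i_4\le d$ such that $$\sum_{i=0}^d\delta_i t^i=1+t^{i_1}+t^{i_2}+t^{i_3}+t^{i_4},$$ and the following are equivalent: (a) there is an integral simplex $\mathcal P\subset\mathbb R^d$ of dimension $d$ (the convex hull of $d+1$ affinely independent points of $\mathbb Z^d$) whose $\delta$-vector is $(\delta_0,\delta_1,\dots,\delta_d)$; (b) $i_1+i_4=i_2+i_3\le d+1$, and $i_k+i_\ell\ge i_{k+\ell}$ for all integers $1\le k\le\ell\le 4$ with $k+\ell\le 4$. Here the $\delta$-vector of an integral convex polytope $\mathcal P\subset\mathbb R^d$ of dimension $d$ consists of the coefficients of $\lambda^0,\dots,\lambda^d$ in the power series $(1-\lambda)^{d+1}\sum_{n\ge 0}|n\mathcal P\cap\mathbb Z^d|\,\lambda^n$, where $n\mathcal P=\{n\alpha:\alpha\in\mathcal P\}$. -/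

import Mathlib

open Polynomial

noncomputable section

/-- The real point of `ℝ^N` with the given integer coordinates. -/
def intPoint {N : ℕ} (z : Fin N → ℤ) : Fin N → ℝ := fun k => (z k : ℝ)

/-- `P ⊆ ℝ^N` is an integral simplex of dimension `d`: the convex hull of `d + 1` affinely
independent points with integer coordinates. -/
def IsIntegralSimplex {N : ℕ} (d : ℕ) (P : Set (Fin N → ℝ)) : Prop :=
  ∃ v : Fin (d + 1) → (Fin N → ℤ),
    AffineIndependent ℝ (fun j => intPoint (v j)) ∧
      P = convexHull ℝ (Set.range fun j => intPoint (v j))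

/-- The number `i(P, n) = |nP ∩ ℤ^N|` of integer points in the dilate `nP = {nα : α ∈ P}`. -/
def ehrhartCount {N : ℕ} (P : Set (Fin N → ℝ)) (n : ℕ) : ℕ :=
  Set.ncard {z : Fin N → ℤ | intPoint z ∈ (fun α => (n : ℝ) • α) '' P}

/-- The power series `(1 - λ)^(d + 1) * ∑ n, i(P, n) λ^n`, where `d` is the dimension of `P`. -/
def deltaSeries {N : ℕ} (d : ℕ) (P : Set (Fin N → ℝ)) : PowerSeries ℤ :=
  (1 - PowerSeries.X) ^ (d + 1) * PowerSeries.mk fun n => (ehrhartCount P n : ℤ)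

/-- The δ-vector `(δ_0, …, δ_d)` of an integral convex polytope `P` of dimension `d`: the
coefficients of `λ^0, …, λ^d` in `deltaSeries d P`. -/
def deltaVector {N : ℕ} (d : ℕ) (P : Set (Fin N → ℝ)) : Fin (d + 1) → ℤ :=
  fun j => PowerSeries.coeff (j : ℕ) (deltaSeries d P)

/-- `i` lists the exponents `1 ≤ i_1 ≤ ⋯ ≤ i_m ≤ d` for which
`∑ j, δ_j t^j = 1 + t^(i_1) + ⋯ + t^(i_m)`. The entry `i_k` is the value of `i` at the
`k`-th element of `Fin m`, that is, at the index `k - 1`. -/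
def IsExponentSequence {d m : ℕ} (δ : Fin (d + 1) → ℕ) (i : Fin m → ℕ) : Prop :=
  Monotone i ∧ (∀ k, 1 ≤ i k ∧ i k ≤ d) ∧
    (∑ j : Fin (d + 1), C (δ j) * X ^ (j : ℕ) : ℕ[X]) = 1 + ∑ k : Fin m, X ^ i k

end

/-!
A lattice simplex with vertices `v j` has a finite group attached to it: the weights `w` with
`∑ j, w j` an integer and `∑ j, w j • v j` an integer point, modulo integer vectors. Its elements
are represented by the weights in `[0, 1)`, the *box*. Splitting a nonnegative weight into its
fractional and integral parts shows that the Ehrhart series is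
`(∑ b ∈ box, λ ^ height b) / (1 - λ) ^ (d + 1)`, where the height is the sum of the coordinates, so
that `δ_j` is the number of box weights of height `j` (`deltaVector_convexHull`).

If the `δ_j` add up to a prime `p`, the group is cyclic of order `p`, and the box consists of the
fractional parts of `k * a / p` for `k < p` and some integer vector `a`
(`exists_residueWeight_of_card_prime`). For `p = 5` the exponents `i` are therefore the heights
`h 1, …, h 4` of the nonzero multiples in some order. Here `h k + h (5 - k)` is the number of nonzero
coordinates of `a`, which gives the equality and the bound by `d + 1`, and the heights are
subadditive in `k` modulo `5`, which gives the other inequalities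
(`exponent_inequalities_of_heights`).

Conversely the conditions make it possible to choose how many coordinates of `a` are `1, 2, 3, 4`
so that `h k` is the `k`-th exponent (`exists_residues`); at least one coordinate can be taken to
be `1`. An explicit simplex, with all but one vertex among `0` and the standard basis vectors, has
the multiples of `a / 5` as its box (`boxWeights_cyclicVertices`).
-/

/-! ### Weights of lattice points and the half-open box -/

/-- The group of weights `w : Fin (d + 1) → ℝ` whose sum is an integer and whose combination
`∑ j, w j • v j` is an integer point. Under affine independence of `v` these are the coordinates,
with respect to the vectors `(v j, 1)`, of the points of `ℤ^N × ℤ` in their span. -/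
def latticeWeights {N d : ℕ} (v : Fin (d + 1) → Fin N → ℤ) : AddSubgroup (Fin (d + 1) → ℝ) where
  carrier := {w | (∃ n : ℤ, ∑ j, w j = n) ∧
    ∃ z : Fin N → ℤ, ∑ j, w j • intPoint (v j) = intPoint z}
  zero_mem' := ⟨⟨0, by simp⟩, 0, by ext; simp [intPoint]⟩
  add_mem' := by
    rintro a b ⟨⟨n, hn⟩, z, hz⟩ ⟨⟨m, hm⟩, y, hy⟩
    refine ⟨⟨n + m, by simp [Finset.sum_add_distrib, hn, hm]⟩, z + y, ?_⟩
    simp only [Pi.add_apply, add_smul, Finset.sum_add_distrib, hz, hy]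
    ext; simp [intPoint]
  neg_mem' := by
    rintro a ⟨⟨n, hn⟩, z, hz⟩
    refine ⟨⟨-n, by simp [hn]⟩, -z, ?_⟩
    simp only [Pi.neg_apply, neg_smul, Finset.sum_neg_distrib, hz]
    ext; simp [intPoint]

/-- The lattice weights with all coordinates in `[0, 1)`: the lattice points of the half-open
parallelepiped spanned by the vectors `(v j, 1)`. -/
def boxWeights {N d : ℕ} (v : Fin (d + 1) → Fin N → ℤ) : Set (Fin (d + 1) → ℝ) :=
  {w | w ∈ latticeWeights v ∧ ∀ j, 0 ≤ w j ∧ w j < 1}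

/-- The sum of the coordinates of a weight. It is rounded down to a natural number, which changes
nothing for nonnegative lattice weights, whose sum is a natural number already. -/
noncomputable def height {d : ℕ} (w : Fin (d + 1) → ℝ) : ℕ := ⌊∑ j, w j⌋₊

lemma intCast_mem_latticeWeights {N d : ℕ} (v : Fin (d + 1) → Fin N → ℤ) (m : Fin (d + 1) → ℤ) :
    (fun j => (m j : ℝ)) ∈ latticeWeights v := by
  refine ⟨⟨∑ j, m j, by simp⟩, fun k => ∑ j, m j * v j k, ?_⟩
  ext k
  simp [intPoint]

lemma fract_mem_boxWeights {N d : ℕ} {v : Fin (d + 1) → Fin N → ℤ} {w : Fin (d + 1) → ℝ}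
    (hw : w ∈ latticeWeights v) : (fun j => Int.fract (w j)) ∈ boxWeights v := by
  refine ⟨?_, fun j => ⟨Int.fract_nonneg _, Int.fract_lt_one _⟩⟩
  have := (latticeWeights v).sub_mem hw (intCast_mem_latticeWeights v fun j => ⌊w j⌋)
  exact this

lemma height_eq_of_mem {N d : ℕ} {v : Fin (d + 1) → Fin N → ℤ} {w : Fin (d + 1) → ℝ}
    (hw : w ∈ latticeWeights v) (h0 : ∀ j, 0 ≤ w j) : ∑ j, w j = (height w : ℝ) := by
  obtain ⟨⟨n, hn⟩, -⟩ := hw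
  have h : 0 ≤ ∑ j, w j := Finset.sum_nonneg fun j _ => h0 j
  rw [hn] at h
  lift n to ℕ using by exact_mod_cast h
  simp [height, hn]

lemma eq_of_sum_eq_of_combination_eq {N d : ℕ} {v : Fin (d + 1) → Fin N → ℤ}
    (hv : AffineIndependent ℝ fun j => intPoint (v j)) {w w' : Fin (d + 1) → ℝ}
    (h : ∑ j, w j = ∑ j, w' j)
    (h' : ∑ j, w j • intPoint (v j) = ∑ j, w' j • intPoint (v j)) : w = w' :=
  funext fun j => hv.eq_of_sum_eq_sum h h' j (Finset.mem_univ j)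

lemma height_le {N d : ℕ} {v : Fin (d + 1) → Fin N → ℤ} {w : Fin (d + 1) → ℝ}
    (hw : w ∈ boxWeights v) : height w ≤ d := by
  have h := height_eq_of_mem hw.1 fun j => (hw.2 j).1
  have h2 : ∑ j, w j < ∑ _j : Fin (d + 1), (1 : ℝ) :=
    Finset.sum_lt_sum_of_nonempty Finset.univ_nonempty fun j _ => (hw.2 j).2
  rw [h] at h2
  simp only [Finset.sum_const, Finset.card_univ, Fintype.card_fin, nsmul_eq_mul, mul_one] at h2
  have : height w < d + 1 := by exact_mod_cast h2
  omega

/-- A box weight is determined by its height and its integer point, both of which are bounded. -/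
lemma finite_boxWeights {N d : ℕ} {v : Fin (d + 1) → Fin N → ℤ}
    (hv : AffineIndependent ℝ fun j => intPoint (v j)) : (boxWeights v).Finite := by
  choose! z hz using fun w (hw : w ∈ boxWeights v) => hw.1.2
  let C : Fin N → ℤ := fun k => ∑ j, |v j k|
  refine Set.Finite.of_injOn (f := fun w => (height w, z w))
    (t := Set.Iic d ×ˢ Set.Icc (-C) C) ?_ ?_ ((Set.finite_Iic d).prod (Set.finite_Icc _ _))
  · intro w hw
    refine ⟨height_le hw, ?_⟩
    have key : ∀ k, |z w k| ≤ C k := by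
      intro k
      have h := congrFun (hz w hw) k
      simp only [Finset.sum_apply, Pi.smul_apply, smul_eq_mul, intPoint] at h
      have : |(z w k : ℝ)| ≤ ∑ j, |(v j k : ℝ)| := by
        rw [← h]
        refine (Finset.abs_sum_le_sum_abs _ _).trans (Finset.sum_le_sum fun j _ => ?_)
        rw [abs_mul, abs_of_nonneg (hw.2 j).1]
        exact mul_le_of_le_one_left (abs_nonneg _) (hw.2 j).2.le
      exact_mod_cast this
    exact ⟨fun k => (abs_le.1 (key k)).1, fun k => (abs_le.1 (key k)).2⟩
  · intro w hw w' hw' h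
    obtain ⟨h1, h2⟩ := Prod.mk.inj h
    refine eq_of_sum_eq_of_combination_eq hv ?_ ?_
    · rw [height_eq_of_mem hw.1 fun j => (hw.2 j).1, height_eq_of_mem hw'.1 fun j => (hw'.2 j).1, h1]
    · rw [hz w hw, hz w' hw', h2]

/-! ### The δ-series of a simplex -/

lemma mem_smul_convexHull_range_iff {ι E : Type*} [Fintype ι] [AddCommGroup E] [Module ℝ E]
    [Nonempty ι] (p : ι → E) (n : ℕ) (x : E) :
    x ∈ (fun α => (n : ℝ) • α) '' convexHull ℝ (Set.range p) ↔
      ∃ w : ι → ℝ, (∀ j, 0 ≤ w j) ∧ ∑ j, w j = n ∧ ∑ j, w j • p j = x := by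
  classical
  have hull : ∀ y, y ∈ convexHull ℝ (Set.range p) ↔
      ∃ w : ι → ℝ, (∀ j, 0 ≤ w j) ∧ ∑ j, w j = 1 ∧ ∑ j, w j • p j = y := by
    intro y
    have h : Set.range p = Fintype.linearCombination ℝ p '' Set.range fun i : ι ↦ Pi.single i 1 := by
      rw [← Set.range_comp]
      congr 1
      ext i
      simp [Fintype.linearCombination_apply_single]
    rw [h, ← LinearMap.image_convexHull, convexHull_rangle_single_eq_stdSimplex]
    simp [stdSimplex, Fintype.linearCombination_apply, and_assoc]
  constructor
  · rintro ⟨y, hy, rfl⟩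
    obtain ⟨w, h0, h1, rfl⟩ := (hull y).1 hy
    refine ⟨fun j => n * w j, fun j => mul_nonneg n.cast_nonneg (h0 j), ?_, ?_⟩
    · rw [← Finset.mul_sum, h1, mul_one]
    · simp [Finset.smul_sum, mul_smul]
  · rintro ⟨w, h0, h1, rfl⟩
    rcases Nat.eq_zero_or_pos n with rfl | hn
    · have hw : ∀ j, w j = 0 := fun j =>
        (Finset.sum_eq_zero_iff_of_nonneg fun j _ => h0 j).1 (by simpa using h1) j
          (Finset.mem_univ j)
      obtain ⟨i⟩ := ‹Nonempty ι›
      exact ⟨p i, subset_convexHull ℝ _ ⟨i, rfl⟩, by simp [hw]⟩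
    · have hn' : (n : ℝ) ≠ 0 := by positivity
      refine ⟨∑ j, ((n : ℝ)⁻¹ * w j) • p j, (hull _).2 ⟨_, fun j => ?_, ?_, rfl⟩, ?_⟩
      · exact mul_nonneg (by positivity) (h0 j)
      · rw [← Finset.mul_sum, h1, inv_mul_cancel₀ hn']
      · simp only [Finset.smul_sum, smul_smul, mul_inv_cancel_left₀ hn']

lemma coeff_mk_one_pow (d n : ℕ) :
    PowerSeries.coeff n ((PowerSeries.mk 1 : PowerSeries ℤ) ^ (d + 1)) =
      ((Finset.univ : Finset (Fin (d + 1))).piAntidiag n).card := by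
  have h := PowerSeries.coeff_prod (fun _ : Fin (d + 1) => (PowerSeries.mk 1 : PowerSeries ℤ)) n
    Finset.univ
  rw [Finset.prod_const, Finset.card_univ, Fintype.card_fin] at h
  rw [h]
  simp [Finset.finsuppAntidiag]

/-- Taking fractional parts splits a nonnegative lattice weight into a box weight and a vector of
natural numbers; so the integer points of the `n`-th dilate correspond to the pairs of a box
weight `b` and a composition of `n - height b`. -/
lemma ehrhartCount_convexHull {N d : ℕ} {v : Fin (d + 1) → Fin N → ℤ}
    (hv : AffineIndependent ℝ fun j => intPoint (v j)) {B : Finset (Fin (d + 1) → ℝ)}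
    (hB : (B : Set (Fin (d + 1) → ℝ)) = boxWeights v) (n : ℕ) :
    ehrhartCount (convexHull ℝ (Set.range fun j => intPoint (v j))) n =
      ∑ b ∈ B, if height b ≤ n then
        ((Finset.univ : Finset (Fin (d + 1))).piAntidiag (n - height b)).card else 0 := by
  classical
  have hBm : ∀ b, b ∈ B ↔ b ∈ boxWeights v := fun b => by rw [← hB, Finset.mem_coe]
  let T : Finset (Σ _ : Fin (d + 1) → ℝ, Fin (d + 1) → ℕ) :=
    B.sigma fun b => if height b ≤ n then Finset.univ.piAntidiag (n - height b) else ∅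
  have hT : ∀ b m, (⟨b, m⟩ : Σ _ : Fin (d + 1) → ℝ, Fin (d + 1) → ℕ) ∈ T ↔
      b ∈ boxWeights v ∧ height b + ∑ j, m j = n := by
    intro b m
    simp only [T, Finset.mem_sigma, hBm]
    refine and_congr_right fun _ => ?_
    split_ifs with h
    · simp only [Finset.mem_piAntidiag, Finset.mem_univ, implies_true, and_true]
      change ∑ j, m j = n - height b ↔ _
      omega
    · simp only [Finset.notMem_empty, false_iff]
      omega
  let W : (Σ _ : Fin (d + 1) → ℝ, Fin (d + 1) → ℕ) → Fin (d + 1) → ℝ := fun t j => t.1 j + t.2 j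
  have hW : ∀ t ∈ T, W t ∈ latticeWeights v ∧ ∑ j, W t j = n := by
    rintro ⟨b, m⟩ ht
    obtain ⟨hb, hm⟩ := (hT b m).1 ht
    constructor
    · have := (latticeWeights v).add_mem hb.1 (intCast_mem_latticeWeights v fun j => (m j : ℤ))
      simpa [W, Pi.add_def] using this
    · simp only [W, Finset.sum_add_distrib]
      rw [height_eq_of_mem hb.1 fun j => (hb.2 j).1, ← hm]
      push_cast; ring
  choose! z hz using fun t ht => (hW t ht).1.2
  have hset : {y : Fin N → ℤ | intPoint y ∈ (fun α => (n : ℝ) • α) ''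
      convexHull ℝ (Set.range fun j => intPoint (v j))} = (T.image z : Finset (Fin N → ℤ)) := by
    ext y
    rw [Set.mem_ofPred_eq, mem_smul_convexHull_range_iff, Finset.mem_coe, Finset.mem_image]
    constructor
    · rintro ⟨w, h0, h1, h2⟩
      have hw : w ∈ latticeWeights v := ⟨⟨n, by simpa using h1⟩, y, h2⟩
      have hf := fract_mem_boxWeights hw
      have hsplit : ∀ j, Int.fract (w j) + (⌊w j⌋₊ : ℝ) = w j := fun j => by
        rw [natCast_floor_eq_intCast_floor (h0 j), Int.fract_add_floor]
      have ht : (⟨fun j => Int.fract (w j), fun j => ⌊w j⌋₊⟩ :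
          Σ _ : Fin (d + 1) → ℝ, Fin (d + 1) → ℕ) ∈ T := by
        rw [hT]
        refine ⟨hf, ?_⟩
        have := height_eq_of_mem hf.1 fun j => (hf.2 j).1
        have h3 : (height (fun j => Int.fract (w j)) : ℝ) + ∑ j, (⌊w j⌋₊ : ℝ) = n := by
          rw [← this, ← Finset.sum_add_distrib, ← h1]
          exact Finset.sum_congr rfl fun j _ => hsplit j
        exact_mod_cast h3
      refine ⟨_, ht, ?_⟩
      have h4 := hz _ ht
      simp only [W, hsplit, h2] at h4
      ext k
      simpa [intPoint] using (congrFun h4 k).symm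
    · rintro ⟨⟨b, m⟩, ht, rfl⟩
      refine ⟨W ⟨b, m⟩, fun j => ?_, (hW _ ht).2, hz _ ht⟩
      exact add_nonneg (((hT b m).1 ht).1.2 j).1 (Nat.cast_nonneg _)
  have hinj : Set.InjOn z T := by
    rintro ⟨b, m⟩ ht ⟨b', m'⟩ ht' h
    have hWW : W ⟨b, m⟩ = W ⟨b', m'⟩ := by
      refine eq_of_sum_eq_of_combination_eq hv ?_ ?_
      · rw [(hW _ ht).2, (hW _ ht').2]
      · rw [hz _ ht, hz _ ht', h]
    have hb := ((hT b m).1 ht).1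
    have hb' := ((hT b' m').1 ht').1
    have e1 : b = b' := by
      ext j
      have := congrArg Int.fract (congrFun hWW j)
      simpa [W, Int.fract_eq_self.2 (hb.2 j), Int.fract_eq_self.2 (hb'.2 j)] using this
    subst e1
    have e2 : m = m' := by
      ext j
      simpa [W] using congrFun hWW j
    rw [e2]
  rw [ehrhartCount, hset, Set.ncard_coe_finset, Finset.card_image_of_injOn hinj, Finset.card_sigma]
  refine Finset.sum_congr rfl fun b _ => ?_
  split_ifs <;> simp

lemma deltaSeries_convexHull {N d : ℕ} {v : Fin (d + 1) → Fin N → ℤ}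
    (hv : AffineIndependent ℝ fun j => intPoint (v j)) {B : Finset (Fin (d + 1) → ℝ)}
    (hB : (B : Set (Fin (d + 1) → ℝ)) = boxWeights v) :
    deltaSeries d (convexHull ℝ (Set.range fun j => intPoint (v j))) =
      ∑ b ∈ B, PowerSeries.X ^ height b := by
  have h : (PowerSeries.mk fun n =>
      (ehrhartCount (convexHull ℝ (Set.range fun j => intPoint (v j))) n : ℤ)) =
      (∑ b ∈ B, PowerSeries.X ^ height b) * (PowerSeries.mk 1) ^ (d + 1) := by
    ext n
    rw [PowerSeries.coeff_mk, ehrhartCount_convexHull hv hB, Finset.sum_mul, map_sum, Nat.cast_sum]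
    refine Finset.sum_congr rfl fun b _ => ?_
    rw [PowerSeries.coeff_X_pow_mul']
    split_ifs
    · rw [coeff_mk_one_pow]
    · simp
  rw [deltaSeries, h, mul_left_comm, ← mul_pow, mul_comm (1 - PowerSeries.X),
    PowerSeries.mk_one_mul_one_sub_eq_one, one_pow, mul_one]

/-- The entries of the δ-vector of a simplex count the box weights of each height. -/
lemma deltaVector_convexHull {N d : ℕ} {v : Fin (d + 1) → Fin N → ℤ}
    (hv : AffineIndependent ℝ fun j => intPoint (v j)) {B : Finset (Fin (d + 1) → ℝ)}
    (hB : (B : Set (Fin (d + 1) → ℝ)) = boxWeights v) (j : Fin (d + 1)) :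
    deltaVector d (convexHull ℝ (Set.range fun j => intPoint (v j))) j =
      ((∑ b ∈ B, X ^ height b : ℕ[X]).coeff j : ℤ) := by
  rw [deltaVector, deltaSeries_convexHull hv hB, map_sum, finsetSum_coeff, Nat.cast_sum]
  refine Finset.sum_congr rfl fun b _ => ?_
  rw [PowerSeries.coeff_X_pow, coeff_X_pow]
  split_ifs <;> simp

/-! ### Exponent sequences -/

lemma sum_X_pow_eq_sum_map {ι : Type*} [Fintype ι] (i : ι → ℕ) :
    (∑ k, X ^ i k : ℕ[X]) = ((Finset.univ.val.map i).map (X ^ ·)).sum := by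
  rw [Multiset.map_map]
  rfl

lemma coeff_sum_map_X_pow (M : Multiset ℕ) (n : ℕ) :
    ((M.map (X ^ ·)).sum : ℕ[X]).coeff n = M.count n := by
  induction M using Multiset.induction_on with
  | empty => simp
  | cons a s ih =>
    rw [Multiset.map_cons, Multiset.sum_cons, coeff_add, ih, coeff_X_pow, Multiset.count_cons]
    ring

lemma map_univ_eq_of_sum_X_pow_eq {ι κ : Type*} [Fintype ι] [Fintype κ] {i : ι → ℕ} {h : κ → ℕ}
    (H : (∑ k, X ^ i k : ℕ[X]) = ∑ k, X ^ h k) :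
    Finset.univ.val.map i = Finset.univ.val.map h := by
  ext n
  rw [← coeff_sum_map_X_pow, ← coeff_sum_map_X_pow, ← sum_X_pow_eq_sum_map,
    ← sum_X_pow_eq_sum_map, H]

lemma exists_monotone_map_univ_eq {α : Type*} [LinearOrder α] {m : ℕ} {M : Multiset α}
    (hM : M.card = m) : ∃ a : Fin m → α, Monotone a ∧ Finset.univ.val.map a = M := by
  subst hM
  have hl : (M.sort (· ≤ ·)).length = M.card := Multiset.length_sort _
  refine ⟨fun k => (M.sort (· ≤ ·)).get (k.cast hl.symm), fun k l hkl => ?_, ?_⟩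
  · exact (Multiset.pairwise_sort M (· ≤ ·)).sortedLE.monotone_get hkl
  · rw [Fin.univ_val_map]
    conv_rhs => rw [← Multiset.sort_eq M (· ≤ ·)]
    congr 1
    refine List.ext_get (by simp) fun n h1 h2 => ?_
    simp

lemma eq_of_monotone_of_map_univ_eq {m : ℕ} {i i' : Fin m → ℕ} (hi : Monotone i)
    (hi' : Monotone i') (h : Finset.univ.val.map i = Finset.univ.val.map i') : i = i' := by
  rw [Fin.univ_val_map, Fin.univ_val_map, Multiset.coe_eq_coe] at h
  exact List.ofFn_injective (h.eq_of_sortedLE hi.sortedLE_ofFn hi'.sortedLE_ofFn)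

lemma eq_of_one_add_eq_one_add {f g : ℕ[X]} (h : 1 + f = 1 + g) : f = g := by
  ext n
  have := congrArg (coeff · n) h
  simpa only [coeff_add, Nat.add_left_cancel_iff] using this

lemma existsUnique_isExponentSequence {d m : ℕ} {δ : Fin (d + 1) → ℕ} (hδ0 : δ 0 = 1)
    (hδ : ∑ j, δ j = m + 1) : ∃! i : Fin m → ℕ, IsExponentSequence δ i := by
  rw [Fin.sum_univ_succ, hδ0] at hδ
  let M : Multiset ℕ := ∑ j : Fin d, Multiset.replicate (δ j.succ) ((j : ℕ) + 1)
  have hM : M.card = m := by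
    simp only [M, Multiset.card_sum, Multiset.card_replicate]
    omega
  obtain ⟨i, hi, hiM⟩ := exists_monotone_map_univ_eq hM
  have hpoly : (∑ j : Fin (d + 1), C (δ j) * X ^ (j : ℕ) : ℕ[X]) = 1 + ∑ k : Fin m, X ^ i k := by
    rw [sum_X_pow_eq_sum_map, hiM, Fin.sum_univ_succ, hδ0]
    have h : ((M.map (X ^ ·)).sum : ℕ[X]) =
        ∑ j : Fin d, ((Multiset.replicate (δ j.succ) ((j : ℕ) + 1)).map (X ^ ·)).sum :=
      map_sum ((Multiset.sumAddMonoidHom : Multiset ℕ[X] →+ ℕ[X]).comp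
        (Multiset.mapAddMonoidHom fun n : ℕ => (X ^ n : ℕ[X]))) _ _
    rw [h]
    simp
  refine ⟨i, ⟨hi, fun k => ?_, hpoly⟩, ?_⟩
  · have hk : i k ∈ M := by
      rw [← hiM]
      exact Multiset.mem_map_of_mem _ (Finset.mem_univ_val k)
    obtain ⟨j, -, hj⟩ := Multiset.mem_sum.1 hk
    have := Multiset.eq_of_mem_replicate hj
    have := j.isLt
    omega
  · rintro i' ⟨hi', -, hp⟩
    rw [hpoly] at hp
    exact eq_of_monotone_of_map_univ_eq hi' hi
      (map_univ_eq_of_sum_X_pow_eq (eq_of_one_add_eq_one_add hp).symm)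

/-! ### Boxes of prime order -/

/-- The weight with coordinates the fractional parts of `k * a j / p`. -/
noncomputable def residueWeight {d : ℕ} (p : ℕ) (a : Fin (d + 1) → ℕ) (k : ℕ) :
    Fin (d + 1) → ℝ :=
  fun j => ((k * a j % p : ℕ) : ℝ) / p

lemma residueWeight_mod {d : ℕ} (p : ℕ) (a : Fin (d + 1) → ℕ) (k : ℕ) :
    residueWeight p a (k % p) = residueWeight p a k := by
  ext j
  simp [residueWeight, Nat.mod_mul_mod]

lemma fract_eq_residueWeight {d : ℕ} (p : ℕ) (a : Fin (d + 1) → ℕ) (k : ℕ) (j : Fin (d + 1)) :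
    Int.fract ((k : ℝ) * (a j / p)) = residueWeight p a k j := by
  rw [residueWeight, ← Int.fract_div_natCast_eq_div_natCast_mod]
  push_cast
  rw [mul_div_assoc]

/-- Modulo integer vectors the lattice weights form a group, of which the box is a system of
representatives. When its order is a prime `p`, it is generated by any nonzero element, and such
an element has coordinates in `p⁻¹ ℤ`. -/
lemma exists_residueWeight_of_card_prime {N d p : ℕ} [hp : Fact p.Prime]
    {v : Fin (d + 1) → Fin N → ℤ} {B : Finset (Fin (d + 1) → ℝ)}
    (hB : (B : Set (Fin (d + 1) → ℝ)) = boxWeights v) (hcard : B.card = p) :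
    ∃ a : Fin (d + 1) → ℕ, (∀ j, a j < p) ∧ B = (Finset.range p).image (residueWeight p a) ∧
      Set.InjOn (residueWeight p a) (Finset.range p) := by
  classical
  have hBm : ∀ b, b ∈ B ↔ b ∈ boxWeights v := fun b => by rw [← hB, Finset.mem_coe]
  have hp0 : (0 : ℝ) < p := by exact_mod_cast hp.out.pos
  let π : (Fin (d + 1) → ℝ) →+ (Fin (d + 1) → AddCircle (1 : ℝ)) :=
    AddMonoidHom.compLeft (QuotientAddGroup.mk' (AddSubgroup.zmultiples (1 : ℝ))) (Fin (d + 1))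
  have hπ : ∀ w w' : Fin (d + 1) → ℝ, π w = π w' → ∀ j, Int.fract (w j) = Int.fract (w' j) := by
    intro w w' h j
    obtain ⟨n, hn⟩ := AddSubgroup.mem_zmultiples_iff.1 (QuotientAddGroup.eq.1 (congrFun h j))
    refine Int.fract_eq_fract.2 ⟨-n, ?_⟩
    push_cast
    simp only [zsmul_eq_mul, mul_one] at hn
    linarith
  have hbox : ∀ b ∈ B, ∀ j, Int.fract (b j) = b j := fun b hb j =>
    Int.fract_eq_self.2 (((hBm b).1 hb).2 j)
  have hinj : Set.InjOn π B := fun b hb b' hb' h => by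
    ext j
    rw [← hbox b hb, ← hbox b' hb', hπ b b' h]
  let G := (latticeWeights v).map π
  have hG : (G : Set (Fin (d + 1) → AddCircle (1 : ℝ))) = π '' B := by
    ext x
    constructor
    · rintro ⟨w, hw, rfl⟩
      refine ⟨_, (hBm _).2 (fract_mem_boxWeights hw), ?_⟩
      ext j
      refine QuotientAddGroup.eq.2 (AddSubgroup.mem_zmultiples_iff.2 ⟨⌊w j⌋, ?_⟩)
      have := Int.fract_add_floor (w j)
      simp only [zsmul_eq_mul, mul_one]
      linarith
    · rintro ⟨b, hb, rfl⟩
      exact ⟨b, ((hBm b).1 hb).1, rfl⟩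
  have hGcard : Nat.card G = p := by
    have : Nat.card G = (G : Set (Fin (d + 1) → AddCircle (1 : ℝ))).ncard := rfl
    rw [this, hG, hinj.ncard_image, Set.ncard_coe_finset, hcard]
  have h0 : (0 : Fin (d + 1) → ℝ) ∈ B :=
    (hBm 0).2 ⟨(latticeWeights v).zero_mem, fun j => by simp⟩
  obtain ⟨b, hb, hb0⟩ := Finset.exists_mem_ne (hcard ▸ hp.out.one_lt) (0 : Fin (d + 1) → ℝ)
  have hbG : π b ∈ G := ⟨b, ((hBm b).1 hb).1, rfl⟩
  have hg0 : (⟨π b, hbG⟩ : G) ≠ 0 := fun h =>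
    hb0 (hinj hb h0 ((congrArg Subtype.val h).trans π.map_zero.symm))
  have hint : ∀ j, ∃ n : ℕ, n < p ∧ b j = n / p := by
    intro j
    have h1 : p • (⟨π b, hbG⟩ : G) = 0 := by rw [← hGcard]; exact card_nsmul_eq_zero'
    have h2 : π (p • b) = π 0 := by
      rw [map_nsmul, map_zero]
      exact congrArg Subtype.val h1
    have h3 := hπ _ _ h2 j
    simp only [Pi.smul_apply, nsmul_eq_mul, Pi.zero_apply, Int.fract_zero] at h3
    obtain ⟨n, hn⟩ := Int.fract_eq_zero_iff.1 h3
    obtain ⟨hj0, hj1⟩ := ((hBm b).1 hb).2 j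
    have hn0 : (0 : ℝ) ≤ n := by rw [hn]; positivity
    lift n to ℕ using by exact_mod_cast hn0
    rw [Int.cast_natCast] at hn
    refine ⟨n, ?_, ?_⟩
    · have : (n : ℝ) < p := by rw [hn]; exact mul_lt_of_lt_one_right hp0 hj1
      exact_mod_cast this
    · rw [hn]; field_simp
  choose a ha hba using hint
  have hsub : B ⊆ (Finset.range p).image (residueWeight p a) := by
    intro b' hb'
    have hb'G : π b' ∈ G := ⟨b', ((hBm b').1 hb').1, rfl⟩
    obtain ⟨k, hk⟩ := (AddSubmonoid.mem_multiples_iff _ _).1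
      (mem_multiples_of_prime_card (g' := (⟨π b', hb'G⟩ : G)) hGcard hg0)
    have h2 : π (k • b) = π b' := by
      rw [map_nsmul]
      exact congrArg Subtype.val hk
    refine Finset.mem_image.2 ⟨k % p, Finset.mem_range.2 (Nat.mod_lt _ hp.out.pos), ?_⟩
    rw [residueWeight_mod]
    ext j
    rw [← hbox b' hb', ← hπ _ _ h2, ← fract_eq_residueWeight, ← hba]
    simp
  have hle : ((Finset.range p).image (residueWeight p a)).card ≤ B.card := by
    rw [hcard]
    exact Finset.card_image_le.trans (Finset.card_range p).le
  have heq := Finset.eq_of_subset_of_card_le hsub hle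
  refine ⟨a, ha, heq, ?_⟩
  rw [← Finset.card_image_iff, ← heq, hcard, Finset.card_range]

/-! ### Simplices with a cyclic box -/

lemma affineIndependent_of_forall_sum_univ {ι E : Type*} [Fintype ι] [AddCommGroup E] [Module ℝ E]
    {p : ι → E} (h : ∀ w : ι → ℝ, ∑ j, w j = 0 → ∑ j, w j • p j = 0 → ∀ j, w j = 0) :
    AffineIndependent ℝ p := by
  classical
  refine affineIndependent_iff.2 fun s w h0 h1 j hj => ?_
  have := h (fun j => if j ∈ s then w j else 0) (by simpa using h0)
    (by simpa [ite_smul] using h1) j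
  simpa [hj] using this

/-- The vertices `0`, `e_k` for `k` not last, and `p e_last - ∑ a (k + 1) e_k`, the sum running over
the `k` that are not last. If `a` is `1` at the last index and `p` divides the sum of `a`,
then the box of this simplex consists of the fractional parts of the multiples of `a / p`. -/
def cyclicVertices {D : ℕ} (p : ℕ) (a : Fin (D + 2) → ℕ) : Fin (D + 2) → Fin (D + 1) → ℤ :=
  Fin.cons 0 (Fin.snoc (fun l k => if k = l.castSucc then 1 else 0)
    (Fin.snoc (fun k => -(a k.castSucc.succ : ℤ)) (p : ℤ)))

lemma sum_smul_cyclicVertices_castSucc {D : ℕ} (p : ℕ) (a : Fin (D + 2) → ℕ)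
    (w : Fin (D + 2) → ℝ) (k : Fin D) :
    (∑ j, w j • intPoint (cyclicVertices p a j)) k.castSucc =
      w k.castSucc.succ - a k.castSucc.succ * w (Fin.last (D + 1)) := by
  rw [Fin.sum_univ_succ, Fin.sum_univ_castSucc]
  simp only [cyclicVertices, intPoint, Pi.add_apply, Finset.sum_apply, Pi.smul_apply, Fin.cons_zero,
    Fin.cons_succ, Fin.snoc_castSucc, smul_eq_mul, Fin.castSucc_inj, Fin.succ_last]
  simp
  ring

lemma sum_smul_cyclicVertices_last {D : ℕ} (p : ℕ) (a : Fin (D + 2) → ℕ)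
    (w : Fin (D + 2) → ℝ) :
    (∑ j, w j • intPoint (cyclicVertices p a j)) (Fin.last D) = p * w (Fin.last (D + 1)) := by
  rw [Fin.sum_univ_succ, Fin.sum_univ_castSucc]
  simp only [cyclicVertices, intPoint, Pi.add_apply, Finset.sum_apply, Pi.smul_apply, Fin.cons_zero,
    Fin.cons_succ, Fin.snoc_castSucc, smul_eq_mul, Fin.succ_last]
  simp [(Fin.castSucc_lt_last _).ne', mul_comm]

lemma affineIndependent_cyclicVertices {D p : ℕ} (hp : 0 < p) (a : Fin (D + 2) → ℕ) :
    AffineIndependent ℝ fun j => intPoint (cyclicVertices p a j) := by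
  refine affineIndependent_of_forall_sum_univ fun w h0 h1 => ?_
  have hlast : w (Fin.last (D + 1)) = 0 := by
    have := sum_smul_cyclicVertices_last p a w
    rw [h1] at this
    simpa [hp.ne'] using this.symm
  have hsucc : ∀ l : Fin (D + 1), w l.succ = 0 := by
    intro l
    induction l using Fin.lastCases with
    | last => rw [Fin.succ_last, hlast]
    | cast k =>
      have := sum_smul_cyclicVertices_castSucc p a w k
      rw [h1, hlast] at this
      simpa using this.symm
  intro j
  induction j using Fin.cases with
  | zero => simpa [Fin.sum_univ_succ, hsucc] using h0
  | succ l => exact hsucc l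

lemma div_mem_latticeWeights_cyclicVertices {D p : ℕ} (hp : 0 < p) {a : Fin (D + 2) → ℕ}
    (ha : a (Fin.last (D + 1)) = 1) (hdvd : p ∣ ∑ j, a j) :
    (fun j => (a j : ℝ) / p) ∈ latticeWeights (cyclicVertices p a) := by
  have hp' : (p : ℝ) ≠ 0 := by positivity
  obtain ⟨n, hn⟩ := hdvd
  refine ⟨⟨n, ?_⟩, Fin.snoc (fun _ => 0) 1, ?_⟩
  · rw [← Finset.sum_div, ← Nat.cast_sum, hn]
    push_cast
    field_simp
  · ext k
    induction k using Fin.lastCases with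
    | last =>
      rw [sum_smul_cyclicVertices_last, ha]
      simp [intPoint, hp']
    | cast k =>
      rw [sum_smul_cyclicVertices_castSucc, ha]
      simp [intPoint, div_eq_mul_inv]

lemma boxWeights_cyclicVertices {D p : ℕ} (hp : 0 < p) {a : Fin (D + 2) → ℕ}
    (ha : a (Fin.last (D + 1)) = 1) (hdvd : p ∣ ∑ j, a j) :
    boxWeights (cyclicVertices p a) = residueWeight p a '' Finset.range p := by
  have hp' : (0 : ℝ) < p := by exact_mod_cast hp
  have hmul : ∀ y : ℕ, (fun j => (y : ℝ) * ((a j : ℝ) / p)) ∈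
      latticeWeights (cyclicVertices p a) := fun y => by
    have := (latticeWeights _).nsmul_mem (div_mem_latticeWeights_cyclicVertices hp ha hdvd) y
    simpa [Pi.smul_def] using this
  ext w
  constructor
  · rintro hw
    obtain ⟨z, hz⟩ := hw.1.2
    have hl := sum_smul_cyclicVertices_last p a w
    obtain ⟨hw0, hw1⟩ := hw.2 (Fin.last (D + 1))
    rw [hz, intPoint] at hl
    have hz0 : (0 : ℝ) ≤ z (Fin.last D) := by rw [hl]; positivity
    have hz1 : (z (Fin.last D) : ℝ) < p := by rw [hl]; exact mul_lt_of_lt_one_right hp' hw1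
    obtain ⟨y, hy⟩ := Int.eq_ofNat_of_zero_le (by exact_mod_cast hz0 : 0 ≤ z (Fin.last D))
    rw [hy, Int.cast_natCast] at hl hz1
    refine ⟨y, by simpa using hz1, ?_⟩
    -- `w` and `y * a / p` agree at the last index, hence modulo `ℤ` at the indices between the
    -- first and the last, and then at the first because both have an integral sum.
    have hsub := (latticeWeights _).sub_mem hw.1 (hmul y)
    set u : Fin (D + 2) → ℝ := w - fun j => (y : ℝ) * ((a j : ℝ) / p) with hu
    have hulast : u (Fin.last (D + 1)) = 0 := by
      simp only [hu, Pi.sub_apply, ha, hl]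
      field_simp
      simp
    have husucc : ∀ l : Fin (D + 1), ∃ n : ℤ, u l.succ = n := by
      intro l
      induction l using Fin.lastCases with
      | last => exact ⟨0, by rw [Fin.succ_last, hulast, Int.cast_zero]⟩
      | cast k =>
        obtain ⟨x, hx⟩ := hsub.2
        have := sum_smul_cyclicVertices_castSucc p a u k
        rw [hx, hulast, mul_zero, sub_zero] at this
        exact ⟨_, this.symm⟩
    have hint : ∀ j, ∃ n : ℤ, u j = n := by
      intro j
      induction j using Fin.cases with
      | succ l => exact husucc l
      | zero =>
        choose m hm using husucc
        obtain ⟨n, hn⟩ := hsub.1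
        rw [Fin.sum_univ_succ] at hn
        refine ⟨n - ∑ l, m l, ?_⟩
        push_cast
        rw [← hn]
        simp [hm]
    ext j
    obtain ⟨n, hn⟩ := hint j
    rw [← fract_eq_residueWeight, ← Int.fract_eq_self.2 (hw.2 j)]
    exact Int.fract_eq_fract.2 ⟨-n, by push_cast; rw [← hn, hu, Pi.sub_apply]; ring⟩
  · rintro ⟨y, -, rfl⟩
    have := fract_mem_boxWeights (hmul y)
    simpa only [fract_eq_residueWeight] using this

lemma injOn_residueWeight {d p : ℕ} (hp : 0 < p) {a : Fin (d + 1) → ℕ}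
    (ha : a (Fin.last d) = 1) : Set.InjOn (residueWeight p a) (Finset.range p) := by
  intro k hk l hl h
  have := congrFun h (Fin.last d)
  simp only [Finset.coe_range, Set.mem_Iio] at hk hl
  simpa [residueWeight, ha, hp.ne', Nat.mod_eq_of_lt hk, Nat.mod_eq_of_lt hl, div_left_inj'] using
    this

/-! ### δ-vectors of sum five -/

lemma height_residueWeight {d p : ℕ} (hp : 0 < p) {a : Fin (d + 1) → ℕ} {k h : ℕ}
    (H : ∑ j, k * a j % p = p * h) : height (residueWeight p a k) = h := by
  have hp' : (p : ℝ) ≠ 0 := by positivity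
  have : ∑ j, residueWeight p a k j = h := by
    simp only [residueWeight]
    rw [← Finset.sum_div, ← Nat.cast_sum, H]
    push_cast
    field_simp
  rw [height, this, Nat.floor_natCast]

lemma coeff_sum_C_mul_X_pow {d : ℕ} (δ : Fin (d + 1) → ℕ) (n : ℕ) :
    (∑ j : Fin (d + 1), C (δ j) * X ^ (j : ℕ) : ℕ[X]).coeff n =
      if h : n < d + 1 then δ ⟨n, h⟩ else 0 := by
  simp only [finsetSum_coeff, coeff_C_mul_X_pow]
  split_ifs with h
  · rw [Finset.sum_eq_single ⟨n, h⟩]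
    · simp
    · intro j _ hj
      exact if_neg fun e => hj (Fin.ext e.symm)
    · simp
  · exact Finset.sum_eq_zero fun j _ => if_neg (by have := j.isLt; omega)

/-- If the δ-vector has sum `p`, the heights of the box weights are those of the multiples
of a single weight `a / p`. -/
lemma exists_heights_of_deltaVector {d p : ℕ} [hp : Fact p.Prime] {δ : Fin (d + 1) → ℕ}
    (hδ : ∑ j, δ j = p) {P : Set (Fin d → ℝ)} (hP : IsIntegralSimplex d P)
    (hPδ : ∀ j, deltaVector d P j = (δ j : ℤ)) :
    ∃ (a : Fin (d + 1) → ℕ) (h : ℕ → ℕ), (∀ j, a j < p) ∧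
      (∀ k < p, ∑ j, k * a j % p = p * h k) ∧
      (∑ j : Fin (d + 1), C (δ j) * X ^ (j : ℕ) : ℕ[X]) = ∑ k ∈ Finset.range p, X ^ h k := by
  classical
  obtain ⟨v, hv, rfl⟩ := hP
  set B := (finite_boxWeights hv).toFinset with hBdef
  have hB : (B : Set (Fin (d + 1) → ℝ)) = boxWeights v := (finite_boxWeights hv).coe_toFinset
  have hpoly : (∑ j : Fin (d + 1), C (δ j) * X ^ (j : ℕ) : ℕ[X]) = ∑ b ∈ B, X ^ height b := by
    ext n
    rw [coeff_sum_C_mul_X_pow]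
    split_ifs with h
    · have := deltaVector_convexHull hv hB ⟨n, h⟩
      rw [hPδ] at this
      exact_mod_cast this
    · rw [finsetSum_coeff]
      refine (Finset.sum_eq_zero fun b hb => ?_).symm
      have := height_le (hB ▸ Finset.mem_coe.2 hb : b ∈ boxWeights v)
      rw [coeff_X_pow, if_neg (by omega)]
  have hcard : B.card = p := by
    have := congrArg (eval 1) hpoly
    simp only [eval_finsetSum, eval_mul, eval_C, eval_pow, eval_X, one_pow, mul_one, hδ,
      Finset.sum_const, smul_eq_mul] at this
    exact this.symm
  obtain ⟨a, ha, hBa, hinj⟩ := exists_residueWeight_of_card_prime hB hcard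
  refine ⟨a, fun k => height (residueWeight p a k), ha, fun k hk => ?_, ?_⟩
  · have hmem : residueWeight p a k ∈ boxWeights v := by
      rw [← hB, hBa]
      exact Finset.mem_coe.2 (Finset.mem_image_of_mem _ (Finset.mem_range.2 hk))
    have h := height_eq_of_mem hmem.1 fun j => (hmem.2 j).1
    have hp' : (p : ℝ) ≠ 0 := by exact_mod_cast hp.out.ne_zero
    simp only [residueWeight] at h
    rw [← Finset.sum_div, ← Nat.cast_sum, div_eq_iff hp', mul_comm] at h
    exact_mod_cast h
  · rw [hpoly, hBa, Finset.sum_image hinj]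

/-- Fractional parts satisfy `{x + y} ≤ {x} + {y}`, and `{x} + {-x}` is the same for all multiples
`x` of `a j / 5` that are not integers; both pass to the heights `h k` of the multiples of `a / 5`.
The inequalities then hold for the sorted heights in whatever order these come. -/
lemma exponent_inequalities_of_heights {d : ℕ} {a : Fin (d + 1) → ℕ} {h : ℕ → ℕ}
    (ha : ∀ j, a j < 5) (hh : ∀ k < 5, ∑ j, k * a j % 5 = 5 * h k) {i : Fin 4 → ℕ}
    (hi : Monotone i)
    (H : Finset.univ.val.map i = Finset.univ.val.map fun k : Fin 4 => h (k + 1)) :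
    i 0 + i 3 = i 1 + i 2 ∧ i 1 + i 2 ≤ d + 1 ∧ i 1 ≤ i 0 + i 0 ∧ i 2 ≤ i 0 + i 1 ∧
      i 3 ≤ i 0 + i 2 ∧ i 3 ≤ i 1 + i 1 := by
  have e1 := hh 1 (by norm_num)
  have e2 := hh 2 (by norm_num)
  have e3 := hh 3 (by norm_num)
  have e4 := hh 4 (by norm_num)
  have b1 : h 1 + h 4 ≤ d + 1 := by
    have : ∑ j, (1 * a j % 5 + 4 * a j % 5) ≤ ∑ _j : Fin (d + 1), 5 :=
      Finset.sum_le_sum fun j _ => by omega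
    rw [Finset.sum_add_distrib, Finset.sum_const, Finset.card_univ, Fintype.card_fin,
      smul_eq_mul] at this
    omega
  have b2 : h 1 + h 4 = h 2 + h 3 := by
    have : ∑ j, (1 * a j % 5 + 4 * a j % 5) = ∑ j, (2 * a j % 5 + 3 * a j % 5) := by
      refine Finset.sum_congr rfl fun j _ => ?_
      have := ha j
      generalize a j = x at this
      interval_cases x <;> rfl
    rw [Finset.sum_add_distrib, Finset.sum_add_distrib] at this
    omega
  have sub : ∀ k < 5, ∀ l < 5, h ((k + l) % 5) ≤ h k + h l := by
    intro k hk l hl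
    have e1 := hh k hk
    have e2 := hh l hl
    have e3 := hh ((k + l) % 5) (Nat.mod_lt _ (by norm_num))
    have : ∑ j, (k + l) % 5 * a j % 5 ≤ ∑ j, (k * a j % 5 + l * a j % 5) := by
      refine Finset.sum_le_sum fun j _ => ?_
      rw [Nat.mod_mul_mod, add_mul, Nat.add_mod]
      exact Nat.mod_le _ _
    rw [Finset.sum_add_distrib] at this
    omega
  have s11 := sub 1 (by norm_num) 1 (by norm_num)
  have s22 := sub 2 (by norm_num) 2 (by norm_num)
  have s33 := sub 3 (by norm_num) 3 (by norm_num)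
  have s44 := sub 4 (by norm_num) 4 (by norm_num)
  have s12 := sub 1 (by norm_num) 2 (by norm_num)
  have s13 := sub 1 (by norm_num) 3 (by norm_num)
  have s24 := sub 2 (by norm_num) 4 (by norm_num)
  have s34 := sub 3 (by norm_num) 4 (by norm_num)
  norm_num at s11 s22 s33 s44 s12 s13 s24 s34
  have m01 : i 0 ≤ i 1 := hi (by decide)
  have m12 : i 1 ≤ i 2 := hi (by decide)
  have m23 : i 2 ≤ i 3 := hi (by decide)
  obtain ⟨σ, hσ⟩ : ∃ σ : Equiv.Perm (Fin 4), ∀ k, i k = h (σ k + 1) := by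
    let f : Fin 4 → ℕ := fun k => h (k + 1)
    refine ⟨Tuple.sort f, congrFun (eq_of_monotone_of_map_univ_eq hi (Tuple.monotone_sort f) ?_)⟩
    change _ = Finset.univ.val.map (f ∘ Tuple.sort f)
    rw [H, ← Multiset.map_map, Multiset.map_univ_val_equiv]
  have hcases : ∀ k, σ k = 0 ∧ i k = h 1 ∨ σ k = 1 ∧ i k = h 2 ∨ σ k = 2 ∧ i k = h 3 ∨
      σ k = 3 ∧ i k = h 4 := by
    intro k
    rw [hσ k]
    generalize σ k = x
    fin_cases x <;> simp
  have hne : ∀ k l, k ≠ l → ∀ x, σ k = x → σ l ≠ x := fun k l hkl x hk hl =>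
    hkl (σ.injective (hk.trans hl.symm))
  have n01 := hne 0 1 (by decide)
  have n02 := hne 0 2 (by decide)
  have n03 := hne 0 3 (by decide)
  have n12 := hne 1 2 (by decide)
  have n13 := hne 1 3 (by decide)
  have n23 := hne 2 3 (by decide)
  have c0 := hcases 0
  have c1 := hcases 1
  have c2 := hcases 2
  have c3 := hcases 3
  clear hcases hne hσ H hi e1 e2 e3 e4 sub hh
  rcases c0 with ⟨p, c0⟩ | ⟨p, c0⟩ | ⟨p, c0⟩ | ⟨p, c0⟩ <;>
  rcases c1 with ⟨q, c1⟩ | ⟨q, c1⟩ | ⟨q, c1⟩ | ⟨q, c1⟩ <;>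
  first
  | exact absurd q (n01 _ p)
  | (rcases c2 with ⟨r, c2⟩ | ⟨r, c2⟩ | ⟨r, c2⟩ | ⟨r, c2⟩ <;>
    first
    | exact absurd r (n02 _ p)
    | exact absurd r (n12 _ q)
    | (rcases c3 with ⟨t, c3⟩ | ⟨t, c3⟩ | ⟨t, c3⟩ | ⟨t, c3⟩ <;>
      first
      | exact absurd t (n03 _ p)
      | exact absurd t (n13 _ q)
      | exact absurd t (n23 _ r)
      | omega))

/-- Residues `a` modulo `5` for which the multiple `(k + 1) * a / 5` has height `i k`: there
are `n₁ + 1`, `n₂`, `n₃` and `n₄` residues equal to `1`, `2`, `3` and `4`, in total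
`i 0 + i 3`, and the others are `0`. -/
lemma exists_residues {D : ℕ} {i : Fin 4 → ℕ} (hi : Monotone i) (h1 : 1 ≤ i 0)
    (hs : i 0 + i 3 = i 1 + i 2) (hd : i 1 + i 2 ≤ D + 2) (h01 : i 1 ≤ i 0 + i 0)
    (h12 : i 2 ≤ i 0 + i 1) :
    ∃ a : Fin (D + 2) → ℕ, a (Fin.last (D + 1)) = 1 ∧ (∑ j, a j) = 5 * i 0 ∧
      ∀ k : Fin 4, ∑ j, (k + 1 : ℕ) * a j % 5 = 5 * i k := by
  have m01 : i 0 ≤ i 1 := hi (by decide)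
  have m12 : i 1 ≤ i 2 := hi (by decide)
  have m23 : i 2 ≤ i 3 := hi (by decide)
  -- The heights prescribe `n₃ + n₄ = 2 * i 0 - i 1` and `n₂ + n₄ = i 0 + i 1 - i 2`; the solution
  -- with `n₄` the smaller of these two numbers is nonnegative.
  obtain ⟨n₁, n₂, n₃, n₄, hn, e0, e1, e2, e3⟩ : ∃ n₁ n₂ n₃ n₄ : ℕ,
      n₁ + n₂ + n₃ + n₄ ≤ D + 1 ∧ (n₁ + 1) + 2 * n₂ + 3 * n₃ + 4 * n₄ = 5 * i 0 ∧
      2 * (n₁ + 1) + 4 * n₂ + n₃ + 3 * n₄ = 5 * i 1 ∧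
      3 * (n₁ + 1) + n₂ + 4 * n₃ + 2 * n₄ = 5 * i 2 ∧
      4 * (n₁ + 1) + 3 * n₂ + 2 * n₃ + n₄ = 5 * i 3 := by
    rcases le_total (i 0 + i 0 - i 1) (i 0 + i 1 - i 2) with h | h
    · exact ⟨i 3 + i 2 - i 1 - 1, (i 0 + i 1 - i 2) - (i 0 + i 0 - i 1), 0, i 0 + i 0 - i 1,
        by omega, by omega, by omega, by omega, by omega⟩
    · exact ⟨i 3 + i 1 - i 0 - 1, 0, (i 0 + i 0 - i 1) - (i 0 + i 1 - i 2), i 0 + i 1 - i 2,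
        by omega, by omega, by omega, by omega, by omega⟩
  obtain ⟨b, -, hb⟩ := exists_monotone_map_univ_eq (m := D + 1)
    (M := Multiset.replicate (D + 1 - (n₁ + n₂ + n₃ + n₄)) 0 + Multiset.replicate n₁ 1 +
      Multiset.replicate n₂ 2 + Multiset.replicate n₃ 3 + Multiset.replicate n₄ 4)
    (by simp; omega)
  have hsum : ∀ f : ℕ → ℕ, ∑ j, f ((Fin.snoc b 1 : Fin (D + 2) → ℕ) j) =
      (D + 1 - (n₁ + n₂ + n₃ + n₄)) * f 0 + (n₁ + 1) * f 1 + n₂ * f 2 + n₃ * f 3 + n₄ * f 4 := by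
    intro f
    have h : ∑ j, f (b j) = ((Finset.univ.val.map b).map f).sum := by
      rw [Multiset.map_map]
      rfl
    rw [Fin.sum_univ_castSucc]
    simp only [Fin.snoc_castSucc, Fin.snoc_last, h, hb]
    simp
    ring
  refine ⟨Fin.snoc b 1, Fin.snoc_last _ _, ?_, fun k => ?_⟩
  · rw [hsum fun x => x]
    omega
  · rw [hsum fun x => (k + 1 : ℕ) * x % 5]
    fin_cases k <;> simp <;> omega

lemma exists_simplex_of_exponents {d : ℕ} {δ : Fin (d + 1) → ℕ} {i : Fin 4 → ℕ}
    (hi : IsExponentSequence δ i) (hs : i 0 + i 3 = i 1 + i 2) (hd : i 1 + i 2 ≤ d + 1)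
    (h01 : i 1 ≤ i 0 + i 0) (h12 : i 2 ≤ i 0 + i 1) :
    ∃ P : Set (Fin d → ℝ), IsIntegralSimplex d P ∧ ∀ j, deltaVector d P j = (δ j : ℤ) := by
  classical
  obtain ⟨hmono, hbd, hpoly⟩ := hi
  obtain ⟨D, rfl⟩ : ∃ D, d = D + 1 := ⟨d - 1, by have := hbd 0; omega⟩
  obtain ⟨a, ha, hsum, hres⟩ := exists_residues hmono (hbd 0).1 hs hd h01 h12
  have hv := affineIndependent_cyclicVertices (p := 5) (by norm_num) a
  refine ⟨_, ⟨cyclicVertices 5 a, hv, rfl⟩, fun j => ?_⟩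
  have hB : (((Finset.range 5).image (residueWeight 5 a) : Finset _) : Set (Fin (D + 2) → ℝ)) =
      boxWeights (cyclicVertices 5 a) := by
    rw [boxWeights_cyclicVertices (by norm_num) ha ⟨_, hsum⟩, Finset.coe_image]
  rw [deltaVector_convexHull hv hB, Finset.sum_image (injOn_residueWeight (by norm_num) ha),
    Finset.sum_range_succ', height_residueWeight (h := 0) (by norm_num) (by simp), pow_zero,
    Finset.sum_range fun k => (X ^ height (residueWeight 5 a (k + 1)) : ℕ[X])]
  have hh : ∀ k : Fin 4, height (residueWeight 5 a (k + 1)) = i k := fun k =>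
    height_residueWeight (by norm_num) (hres k)
  simp only [hh]
  rw [add_comm, ← hpoly, coeff_sum_C_mul_X_pow, dif_pos j.isLt]

theorem theorem0p2 (d : ℕ) (δ : Fin (d + 1) → ℕ) (hδ0 : δ 0 = 1) (hδ : ∑ j, δ j = 5) :
    (∃! i : Fin 4 → ℕ, IsExponentSequence δ i) ∧
      ∀ i : Fin 4 → ℕ, IsExponentSequence δ i →
        ((∃ P : Set (Fin d → ℝ), IsIntegralSimplex d P ∧ ∀ j, deltaVector d P j = (δ j : ℤ)) ↔
          (i 0 + i 3 = i 1 + i 2 ∧ i 1 + i 2 ≤ d + 1 ∧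
            ∀ k l m : Fin 4, k ≤ l →
              ((k : ℕ) + 1) + ((l : ℕ) + 1) = (m : ℕ) + 1 → i m ≤ i k + i l)) := by
  refine ⟨existsUnique_isExponentSequence hδ0 hδ, fun i hi => ⟨?_, ?_⟩⟩
  · rintro ⟨P, hP, hPδ⟩
    have : Fact (Nat.Prime 5) := ⟨by norm_num⟩
    obtain ⟨a, h, ha, hh, hpoly⟩ := exists_heights_of_deltaVector hδ hP hPδ
    have h0 : h 0 = 0 := by simpa using (hh 0 (by norm_num)).symm
    rw [hi.2.2, Finset.sum_range_succ', h0, pow_zero, add_comm _ (1 : ℕ[X]),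
      Finset.sum_range fun k => (X ^ h (k + 1) : ℕ[X])] at hpoly
    obtain ⟨q0, q1, q2, q3, q4, q5⟩ := exponent_inequalities_of_heights ha hh hi.1
      (map_univ_eq_of_sum_X_pow_eq (eq_of_one_add_eq_one_add hpoly))
    refine ⟨q0, q1, fun k l m hkl hm => ?_⟩
    fin_cases k <;> fin_cases l <;> fin_cases m <;> simp at hkl hm ⊢ <;> omega
  · rintro ⟨hs, hd, hsub⟩
    exact exists_simplex_of_exponents hi hs hd (hsub 0 0 1 le_rfl rfl)
      (hsub 0 1 2 (by decide) rfl)
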